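/- For real $\alpha>-1$ and $n\ge 0$ let $$P_n^{(\alpha,\alpha)}(x)=\frac1{n!}\sum_{k=0}^n\binom nk (n+2\alpha+1)_k(\alpha+k+1)_{n-k}\Big(\frac{x-1}2\Big)^k$$ be the symmetric Jacobi polynomials in the standard normalization, where $(c)_0=1$ and $(c)_k=c(c+1)\cdots(c+k-1)$. Let $c_\alpha=\big(\int_{-1}^1(1-x^2)^\alpha\,dx\big)^{-1}$, so that $c_\alpha(1-x^2)^\alpha$ is a probability density on $(-1,1)$, and let $$P_n(\alpha;x)=P_n^{(\alpha,\alpha)}(x)\Big/\Big(c_\alpha\int_{-1}^1[P_n^{(\alpha,\alpha)}(t)]^2(1-t^2)^\alpha\,dt\Big)^{1/2}$$ be the corresponding orthonormal polynomials. (i) For $\alpha\ge\tfrac12$, $$\inf\{P_n(\alpha;x)^2+P_{n-1}(\alpha;x)^2 : x\in\mathbb R,\ n\ge1\}\ \ge\ \frac{2}{2\alpha+3}.$$ (ii) For $-1<\alpha<\tfrac12$, $$\inf\{P_n(\alpha;x)^2+P_{n-1}(\alpha;x)^2 : x\in\mathbb R,\ n\ge1\}=0;$$ that is, the lower boundedness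 condition (LB), which requires this infimum to be strictly positive, fails. -/

import Mathlib

open Polynomial

/-- The Jacobi polynomial `P_n^{(a,b)}` in the standard (Szegő) normalization,
`(1/n!) ∑_{k=0}^n (n choose k) (n+a+b+1)_k (a+k+1)_{n-k} ((x-1)/2)^k`,
where `(c)_k = c (c+1) ⋯ (c+k-1)` is the Pochhammer symbol. -/
noncomputable def jacobiPoly (a b : ℝ) (n : ℕ) : ℝ[X] :=
  C ((n.factorial : ℝ)⁻¹) * ∑ k ∈ Finset.range (n + 1),
    C ((n.choose k : ℝ) * (ascPochhammer ℝ k).eval ((n : ℝ) + a + b + 1) *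
        (ascPochhammer ℝ (n - k)).eval (a + (k : ℝ) + 1)) *
      (C (1 / 2 : ℝ) * (X - 1)) ^ k

/-- The constant `c_α` for which `c_α (1 - x²)^α` is a probability density on `(-1, 1)`
(for `α > -1`). -/
noncomputable def ultraConst (α : ℝ) : ℝ :=
  (∫ x in (-1 : ℝ)..1, (1 - x ^ 2) ^ α)⁻¹

/-- The squared `L²`-norm of `P_n^{(α,α)}` with respect to the probability measure
`c_α (1 - x²)^α dx` on `(-1, 1)`. -/
noncomputable def symmJacobiNormSq (α : ℝ) (n : ℕ) : ℝ :=
  ultraConst α *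
    ∫ x in (-1 : ℝ)..1, ((jacobiPoly α α n).eval x) ^ 2 * (1 - x ^ 2) ^ α

/-- The orthonormal symmetric Jacobi polynomial `P_n(α; x)`: the Jacobi polynomial
`P_n^{(α,α)}` divided by its norm in `L²(c_α (1 - x²)^α dx)`. -/
noncomputable def orthonormalJacobi (α : ℝ) (n : ℕ) : ℝ[X] :=
  C (√(symmJacobiNormSq α n))⁻¹ * jacobiPoly α α n

/-- The infimum of `P_n(x)² + P_{n-1}(x)²` over all real `x` and all integers `n ≥ 1`
(the set is nonempty and bounded below by `0`, so this is a genuine infimum). -/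
noncomputable def consecutiveInf (P : ℕ → ℝ[X]) : ℝ :=
  sInf {y : ℝ | ∃ (x : ℝ) (n : ℕ), 1 ≤ n ∧
    y = ((P n).eval x) ^ 2 + ((P (n - 1)).eval x) ^ 2}

/-- The lower boundedness condition (LB). -/
def LowerBounded (P : ℕ → ℝ[X]) : Prop :=
  0 < consecutiveInf P

/-!
Let `u_n` be the Jacobi polynomial `P_n^{(α,α)}` divided by its value at `1`, and `h_n` its squared
norm, so that the orthonormal polynomials are `p_n = u_n / √h_n`. A comparison of coefficients in
powers of `(x - 1) / 2` gives `(n + 2α + 2) u_{n+2} = (2n + 2α + 3) x u_{n+1} - (n + 1) u_n`; hence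
come the lowering relation for `u_n'` and the differential equation of `u_n`. By the latter and an
integration by parts the `u_n` are orthogonal, and then the recurrence yields the ratio
`h_{n+1} / h_n` (`ultraNormSq_succ`).

For `α ≥ 1/2` the coefficients in `x p_n = a_{n+1} p_{n+1} + a_n p_{n-1}` increase and are at most
`1/2`. The form `a_n² (p_n² + p_{n-1}²) - a_n x p_n p_{n-1}` therefore increases with `n`, from
`a_1² = 1 / (2α + 3)` on; for `|x| ≤ 1` it is at most `(p_n² + p_{n-1}²) / 2`
(`two_mul_sq_le_add_sq`). For `|x| > 1` each `p_n(x)²` is at least `p_n(1)²`.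

For `α < -1/2` already `p_n(1)² = 1 / h_n` tends to zero. For `-1/2 ≤ α < 1/2` the point `x` is a
zero of `p_n` with `1 - x = O(n⁻²)`, which exists by a comparison argument of Sturm type
(`exists_ultraPoly_eval_eq_zero`). The energy `(1 - x²) u_n'² + n (n + 2α + 1) u_n²` increases on
`[0, 1]`, so there `(1 - x²) u_n'(x)² ≤ n (n + 2α + 1)`, and by the lowering relation
`u_{n-1}(x)² = O(n⁻²)`. Since `1 / h_n` grows like `n^(2α + 1)`, `p_{n-1}(x)²` tends to zero.
-/

/-! ### The normalized ultraspherical polynomials and their recurrence -/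

/-- The coefficient of `((x - 1) / 2)^k` in `P_n^{(α,α)}(x) / P_n^{(α,α)}(1)`. -/
noncomputable def ultraCoeff (α : ℝ) (n k : ℕ) : ℝ :=
  (n.choose k : ℝ) * (ascPochhammer ℝ k).eval ((n : ℝ) + 2 * α + 1) /
    (ascPochhammer ℝ k).eval (α + 1)

/-- The ultraspherical polynomial `P_n^{(α,α)}` normalized by the value `1` at `1`. This
normalization, unlike that of Gegenbauer, does not degenerate at `α = -1/2`. -/
noncomputable def ultraPoly (α : ℝ) (n : ℕ) : ℝ[X] :=
  ∑ k ∈ Finset.range (n + 1), C (ultraCoeff α n k) * (C (1 / 2 : ℝ) * (X - 1)) ^ k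

lemma ascPochhammer_eval_succ_left (k : ℕ) (x : ℝ) :
    (ascPochhammer ℝ (k + 1)).eval x = x * (ascPochhammer ℝ k).eval (x + 1) := by
  simp [ascPochhammer_succ_left, eval_comp]

lemma ascPochhammer_eval_add (j k : ℕ) (x : ℝ) :
    (ascPochhammer ℝ (j + k)).eval x =
      (ascPochhammer ℝ j).eval x * (ascPochhammer ℝ k).eval (x + j) := by
  rw [← ascPochhammer_mul, eval_mul, eval_comp]
  simp

theorem jacobiPoly_eq_ultraPoly {α : ℝ} (hα : -1 < α) (n : ℕ) :
    jacobiPoly α α n =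
      C ((ascPochhammer ℝ n).eval (α + 1) / (n.factorial : ℝ)) * ultraPoly α n := by
  unfold jacobiPoly ultraPoly
  rw [div_eq_inv_mul (eval _ _), C_mul, mul_assoc]
  refine congrArg _ ?_
  rw [Finset.mul_sum]
  refine Finset.sum_congr rfl fun k hk => ?_
  rw [← mul_assoc, ← C_mul]
  congr 2
  have hk : k ≤ n := by simpa [Nat.lt_succ_iff] using hk
  have h := ascPochhammer_eval_add k (n - k) (α + 1)
  rw [Nat.add_sub_cancel' hk] at h
  have hp := ascPochhammer_pos k (α + 1) (by linarith)
  rw [h, ultraCoeff, show (n : ℝ) + α + α + 1 = n + 2 * α + 1 by ring,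
    show α + (k : ℝ) + 1 = α + 1 + k by ring]
  field_simp

/-- With the binomial coefficient written as a rising factorial of `-n`, a shift of `n` or `k`
multiplies the coefficient by rational factors, without a case distinction at `k > n`. -/
lemma ultraCoeff_eq (α : ℝ) (n k : ℕ) :
    ultraCoeff α n k = (-1) ^ k * (ascPochhammer ℝ k).eval (-(n : ℝ)) *
      (ascPochhammer ℝ k).eval ((n : ℝ) + 2 * α + 1) /
        ((k.factorial : ℝ) * (ascPochhammer ℝ k).eval (α + 1)) := by
  have h : (-1) ^ k * (ascPochhammer ℝ k).eval (-(n : ℝ)) =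
      (k.factorial : ℝ) * (n.choose k : ℝ) := by
    rw [ascPochhammer_eval_neg_eq_descPochhammer, ← mul_assoc, ← mul_pow,
      descPochhammer_eval_eq_descFactorial, Nat.descFactorial_eq_factorial_mul_choose]
    simp
  have hf : (k.factorial : ℝ) ≠ 0 := by positivity
  rw [h, ultraCoeff, mul_assoc, mul_div_mul_left _ _ hf]

lemma ultraCoeff_zero (α : ℝ) (n : ℕ) : ultraCoeff α n 0 = 1 := by simp [ultraCoeff]

lemma ultraCoeff_one (α : ℝ) (n : ℕ) :
    ultraCoeff α n 1 = n * (n + 2 * α + 1) / (α + 1) := by simp [ultraCoeff]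

lemma ultraCoeff_recurrence {α : ℝ} (hα : -1 < α) (n k : ℕ) :
    ((n : ℝ) + 2 * α + 2) * ultraCoeff α (n + 2) (k + 1) =
      (2 * n + 2 * α + 3) * (ultraCoeff α (n + 1) (k + 1) + 2 * ultraCoeff α (n + 1) k) -
        (n + 1) * ultraCoeff α n (k + 1) := by
  have h1 : α + 1 ≠ 0 := by linarith
  rcases k with _ | k
  · simp only [zero_add, ultraCoeff_zero, ultraCoeff_one]
    push_cast
    field_simp
    ring
  · have hp := (ascPochhammer_pos k (α + 1) (by linarith)).ne'
    have h2 : α + 1 + k ≠ 0 := by have : (0 : ℝ) ≤ k := k.cast_nonneg; linarith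
    have h3 : α + 1 + (k + 1) ≠ 0 := by have : (0 : ℝ) ≤ k := k.cast_nonneg; linarith
    have hf : (k.factorial : ℝ) ≠ 0 := by positivity
    have hk1 : (k : ℝ) + 1 ≠ 0 := by positivity
    have hk2 : (k : ℝ) + 1 + 1 ≠ 0 := by positivity
    -- Each rising factorial is expressed through the one of length `k` based at `-n`, at
    -- `n + 2α + 3` or at `α + 1`; the identity is then one of rational functions.
    have e1 : (ascPochhammer ℝ (k + 2)).eval (-((n + 2 : ℕ) : ℝ)) =
        (n + 2) * (n + 1) * (ascPochhammer ℝ k).eval (-(n : ℝ)) := by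
      rw [ascPochhammer_eval_succ_left, ascPochhammer_eval_succ_left]
      push_cast
      rw [show (-((n : ℝ) + 2) + 1 + 1) = -n by ring]; ring
    have e2 : (ascPochhammer ℝ (k + 2)).eval (-((n + 1 : ℕ) : ℝ)) =
        -((n + 1) * (ascPochhammer ℝ k).eval (-(n : ℝ)) * (k - n)) := by
      rw [ascPochhammer_eval_succ_left, ascPochhammer_succ_eval]
      push_cast
      rw [show (-((n : ℝ) + 1) + 1) = -n by ring]; ring
    have e3 : (ascPochhammer ℝ (k + 1)).eval (-((n + 1 : ℕ) : ℝ)) =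
        -((n + 1) * (ascPochhammer ℝ k).eval (-(n : ℝ))) := by
      rw [ascPochhammer_eval_succ_left]
      push_cast
      rw [show (-((n : ℝ) + 1) + 1) = -n by ring]; ring
    have e4 : (ascPochhammer ℝ (k + 2)).eval (-(n : ℝ)) =
        (ascPochhammer ℝ k).eval (-(n : ℝ)) * (k - n) * (k + 1 - n) := by
      rw [ascPochhammer_succ_eval, ascPochhammer_succ_eval]
      push_cast; ring
    have f1 : (ascPochhammer ℝ (k + 2)).eval (((n + 2 : ℕ) : ℝ) + 2 * α + 1) =
        (ascPochhammer ℝ k).eval ((n : ℝ) + 2 * α + 3) * (n + 2 * α + 3 + k) *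
          (n + 2 * α + 4 + k) := by
      rw [ascPochhammer_succ_eval, ascPochhammer_succ_eval]
      push_cast
      rw [show (n : ℝ) + 2 + 2 * α + 1 = n + 2 * α + 3 by ring]; ring
    have f2 : (ascPochhammer ℝ (k + 2)).eval (((n + 1 : ℕ) : ℝ) + 2 * α + 1) =
        (n + 2 * α + 2) * (ascPochhammer ℝ k).eval ((n : ℝ) + 2 * α + 3) *
          (n + 2 * α + 3 + k) := by
      rw [ascPochhammer_eval_succ_left, ascPochhammer_succ_eval]
      push_cast
      rw [show (n : ℝ) + 1 + 2 * α + 1 + 1 = n + 2 * α + 3 by ring]; ring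
    have f3 : (ascPochhammer ℝ (k + 1)).eval (((n + 1 : ℕ) : ℝ) + 2 * α + 1) =
        (n + 2 * α + 2) * (ascPochhammer ℝ k).eval ((n : ℝ) + 2 * α + 3) := by
      rw [ascPochhammer_eval_succ_left]
      push_cast
      rw [show (n : ℝ) + 1 + 2 * α + 1 + 1 = n + 2 * α + 3 by ring]; ring
    have f4 : (ascPochhammer ℝ (k + 2)).eval ((n : ℝ) + 2 * α + 1) =
        (n + 2 * α + 1) * (n + 2 * α + 2) *
          (ascPochhammer ℝ k).eval ((n : ℝ) + 2 * α + 3) := by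
      rw [ascPochhammer_eval_succ_left, ascPochhammer_eval_succ_left]
      rw [show (n : ℝ) + 2 * α + 1 + 1 + 1 = n + 2 * α + 3 by ring]; ring
    have g1 : (ascPochhammer ℝ (k + 2)).eval (α + 1) =
        (ascPochhammer ℝ k).eval (α + 1) * (α + 1 + k) * (α + 1 + (k + 1)) := by
      rw [ascPochhammer_succ_eval, ascPochhammer_succ_eval]
      push_cast; ring
    have g2 : (ascPochhammer ℝ (k + 1)).eval (α + 1) =
        (ascPochhammer ℝ k).eval (α + 1) * (α + 1 + k) := by
      rw [ascPochhammer_succ_eval]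
    simp only [ultraCoeff_eq, show k + 1 + 1 = k + 2 from rfl, e1, e2, e3, e4, f1, f2, f3, f4,
      g1, g2, Nat.factorial_succ, pow_succ]
    generalize (ascPochhammer ℝ k).eval (-(n : ℝ)) = A
    generalize (ascPochhammer ℝ k).eval ((n : ℝ) + 2 * α + 3) = B
    generalize (ascPochhammer ℝ k).eval (α + 1) = P at *
    push_cast
    field_simp
    ring

lemma ultraPoly_eq_comp (α : ℝ) {n N : ℕ} (h : n < N) :
    ultraPoly α n =
      (∑ k ∈ Finset.range N, C (ultraCoeff α n k) * X ^ k).comp (C (1 / 2 : ℝ) * (X - 1)) := by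
  simp only [Polynomial.sum_comp, mul_comp, C_comp, X_pow_comp]
  unfold ultraPoly
  refine Finset.sum_subset (by simpa using h) fun k _ hk => ?_
  have : n < k := by simpa using hk
  simp [ultraCoeff, Nat.choose_eq_zero_of_lt this]

theorem ultraPoly_zero (α : ℝ) : ultraPoly α 0 = 1 := by simp [ultraPoly, ultraCoeff]

theorem ultraPoly_one {α : ℝ} (hα : -1 < α) : ultraPoly α 1 = X := by
  have h1 : α + 1 ≠ 0 := by linarith
  have h2 : ultraCoeff α 1 1 = 2 := by
    rw [ultraCoeff_one]; push_cast; field_simp; ring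
  simp only [ultraPoly, Finset.sum_range_succ, Finset.sum_range_zero, ultraCoeff_zero, h2, zero_add]
  rw [pow_one, ← mul_assoc, ← C_mul]
  norm_num

theorem ultraPoly_recurrence {α : ℝ} (hα : -1 < α) (n : ℕ) :
    C ((n : ℝ) + 2 * α + 2) * ultraPoly α (n + 2) =
      C (2 * (n : ℝ) + 2 * α + 3) * (X * ultraPoly α (n + 1)) -
        C ((n : ℝ) + 1) * ultraPoly α n := by
  have hX : C (1 : ℝ) + C 2 * (C (1 / 2 : ℝ) * (X - 1)) = X := by
    rw [← mul_assoc, ← C_mul]; norm_num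
  set q : ℕ → ℝ[X] := fun m => ∑ k ∈ Finset.range (n + 3), C (ultraCoeff α m k) * X ^ k with hq
  have hc : ∀ m, m < n + 3 → ∀ k, (q m).coeff k = ultraCoeff α m k := by
    intro m hm k
    simp only [hq, finsetSum_coeff, coeff_C_mul, coeff_X_pow, mul_ite, mul_one, mul_zero]
    rw [Finset.sum_ite_eq]
    split_ifs with h
    · rfl
    · have : m < k := by simp at h; omega
      simp [ultraCoeff, Nat.choose_eq_zero_of_lt this]
  have key : C ((n : ℝ) + 2 * α + 2) * q (n + 2) =
      C (2 * (n : ℝ) + 2 * α + 3) * ((C 1 + C 2 * X) * q (n + 1)) - C ((n : ℝ) + 1) * q n := by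
    ext k
    rw [add_mul, mul_assoc]
    rcases k with _ | k
    · simp only [coeff_sub, coeff_C_mul, coeff_add, coeff_X_mul_zero, hc n (by omega),
        hc (n + 1) (by omega), hc (n + 2) (by omega), ultraCoeff_zero]
      ring
    · simp only [coeff_sub, coeff_C_mul, coeff_add, coeff_X_mul, hc n (by omega),
        hc (n + 1) (by omega), hc (n + 2) (by omega), one_mul]
      exact ultraCoeff_recurrence hα n k
  have h := congrArg (fun p => p.comp (C (1 / 2 : ℝ) * (X - 1))) key
  simp only [sub_comp, mul_comp, add_comp, C_comp, X_comp, hX] at h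
  rwa [← ultraPoly_eq_comp α (show n < n + 3 by omega),
    ← ultraPoly_eq_comp α (show n + 1 < n + 3 by omega),
    ← ultraPoly_eq_comp α (show n + 2 < n + 3 by omega)] at h

theorem ultraPoly_eval_recurrence {α : ℝ} (hα : -1 < α) (n : ℕ) (x : ℝ) :
    ((n : ℝ) + 2 * α + 2) * (ultraPoly α (n + 2)).eval x =
      (2 * n + 2 * α + 3) * x * (ultraPoly α (n + 1)).eval x -
        (n + 1) * (ultraPoly α n).eval x := by
  have h := congrArg (eval x) (ultraPoly_recurrence hα n)
  simp only [eval_mul, eval_sub, eval_C, eval_X] at h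
  linarith

theorem ultraPoly_eval_one (α : ℝ) (n : ℕ) : (ultraPoly α n).eval 1 = 1 := by
  simp only [ultraPoly, eval_finsetSum, eval_mul, eval_C, eval_pow, eval_sub, eval_X, eval_one,
    sub_self, mul_zero]
  rw [Finset.sum_eq_single 0 (fun k _ hk => by simp [hk]) (by simp)]
  simp [ultraCoeff_zero]

/-- Every coefficient in powers of `(x - 1) / 2` is nonnegative and the constant one is `1`. -/
theorem one_le_ultraPoly_eval {α : ℝ} (hα : -1 < α) (n : ℕ) {x : ℝ} (hx : 1 ≤ x) :
    1 ≤ (ultraPoly α n).eval x := by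
  simp only [ultraPoly, eval_finsetSum, eval_mul, eval_C, eval_pow, eval_sub, eval_X, eval_one]
  have h0 : ∀ k ∈ Finset.range (n + 1), 0 ≤ ultraCoeff α n k * (1 / 2 * (x - 1)) ^ k := by
    intro k hk
    refine mul_nonneg ?_ (pow_nonneg (by linarith) _)
    rcases n with _ | n
    · obtain rfl : k = 0 := by simpa using hk
      simp [ultraCoeff]
    · have hn : (0 : ℝ) ≤ n := n.cast_nonneg
      exact div_nonneg (mul_nonneg (Nat.cast_nonneg _)
        (ascPochhammer_pos _ _ (by push_cast; linarith)).le)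
        (ascPochhammer_pos _ _ (by linarith)).le
  simpa [ultraCoeff_zero] using Finset.single_le_sum h0 (Finset.mem_range.2 n.succ_pos)

theorem ultraPoly_eval_neg {α : ℝ} (hα : -1 < α) (n : ℕ) (x : ℝ) :
    (ultraPoly α n).eval (-x) = (-1) ^ n * (ultraPoly α n).eval x := by
  induction n using Nat.twoStepInduction with
  | zero => simp [ultraPoly_zero]
  | one => simp [ultraPoly_one hα]
  | more n ih0 ih1 =>
    have hn : (0 : ℝ) ≤ n := n.cast_nonneg
    have h : (n : ℝ) + 2 * α + 2 ≠ 0 := by linarith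
    refine mul_left_cancel₀ h ?_
    rw [ultraPoly_eval_recurrence hα, ih0, ih1]
    linear_combination (-(-1 : ℝ) ^ n) * ultraPoly_eval_recurrence hα n x

theorem one_le_ultraPoly_eval_sq {α : ℝ} (hα : -1 < α) (n : ℕ) {x : ℝ} (hx : 1 ≤ |x|) :
    1 ≤ (ultraPoly α n).eval x ^ 2 := by
  rcases le_abs.1 hx with h | h
  · exact one_le_pow₀ (one_le_ultraPoly_eval hα n h)
  · have h1 := one_le_pow₀ (n := 2) (one_le_ultraPoly_eval hα n h)
    rw [ultraPoly_eval_neg hα, mul_pow, ← pow_mul, mul_comm n 2, pow_mul] at h1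
    simpa using h1

/-! ### Derivatives and the differential equation -/

lemma ultraPoly_derivative_eval_recurrence {α : ℝ} (hα : -1 < α) (n : ℕ) (x : ℝ) :
    ((n : ℝ) + 2 * α + 2) * (derivative (ultraPoly α (n + 2))).eval x =
      (2 * n + 2 * α + 3) * ((ultraPoly α (n + 1)).eval x +
        x * (derivative (ultraPoly α (n + 1))).eval x) -
        (n + 1) * (derivative (ultraPoly α n)).eval x := by
  have h := congrArg (fun p => (derivative p).eval x) (ultraPoly_recurrence hα n)
  simpa only [derivative_mul, derivative_C, derivative_X, derivative_sub, eval_mul, eval_sub,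
    eval_add, eval_C, eval_X, eval_one, zero_mul, zero_add, one_mul] using h

/-- The lowering relation `(1 - x²) u_{n+1}' = (n + 1) (u_n - x u_{n+1})`. -/
theorem ultraPoly_derivative_eval {α : ℝ} (hα : -1 < α) (n : ℕ) (x : ℝ) :
    (1 - x ^ 2) * (derivative (ultraPoly α (n + 1))).eval x =
      (n + 1) * ((ultraPoly α n).eval x - x * (ultraPoly α (n + 1)).eval x) := by
  induction n using Nat.twoStepInduction with
  | zero => simp [ultraPoly_zero, ultraPoly_one hα, sq]
  | one =>
    have h : 2 * α + 2 ≠ 0 := by linarith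
    have r := ultraPoly_eval_recurrence hα 0 x
    have d := ultraPoly_derivative_eval_recurrence hα 0 x
    simp only [zero_add, ultraPoly_zero, ultraPoly_one hα, Nat.cast_zero, derivative_X,
      derivative_one, eval_one, eval_X, eval_zero, mul_zero, Nat.cast_one, Nat.reduceAdd]
      at r d ⊢
    refine mul_left_cancel₀ h ?_
    linear_combination (1 - x ^ 2) * d + 2 * x * r
  | more n i0 i1 =>
    have hn : (0 : ℝ) ≤ n := n.cast_nonneg
    have h : (n : ℝ) + 1 + 2 * α + 2 ≠ 0 := by linarith
    have r0 := ultraPoly_eval_recurrence hα n x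
    have r1 := ultraPoly_eval_recurrence hα (n + 1) x
    have d := ultraPoly_derivative_eval_recurrence hα (n + 1) x
    refine mul_left_cancel₀ h ?_
    push_cast at *
    linear_combination (1 - x ^ 2) * d + (2 * n + 2 * α + 5) * x * i1 - (n + 2) * i0 -
      (n + 2) * r0 + (n + 3) * x * r1

/-- The raising relation for the derivative, freed of its factor `1 - x²`. -/
lemma ultraPoly_derivative_raise {α : ℝ} (hα : -1 < α) (n : ℕ) :
    C ((n : ℝ) + 1) * derivative (ultraPoly α n) =
      C ((n : ℝ) + 2 * α + 1) * (X * derivative (ultraPoly α (n + 1)) -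
        C ((n : ℝ) + 1) * ultraPoly α (n + 1)) := by
  rcases n with _ | n
  · simp [ultraPoly_zero, ultraPoly_one hα]
  have h : (1 - X ^ 2 : ℝ[X]) ≠ 0 := by
    intro h
    simpa using congrArg (eval 0) h
  refine mul_left_cancel₀ h (Polynomial.funext fun x => ?_)
  have r := ultraPoly_eval_recurrence hα n x
  have d0 := ultraPoly_derivative_eval hα n x
  have d1 := ultraPoly_derivative_eval hα (n + 1) x
  simp only [eval_mul, eval_sub, eval_C, eval_X, eval_pow, eval_one]
  push_cast at *
  linear_combination (n + 2) * d0 + (n + 2) * r - (n + 2 * α + 2) * x * d1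

/-- The Gegenbauer differential equation. -/
theorem ultraPoly_ode {α : ℝ} (hα : -1 < α) (n : ℕ) (x : ℝ) :
    (1 - x ^ 2) * (derivative (derivative (ultraPoly α n))).eval x =
      (2 * α + 2) * x * (derivative (ultraPoly α n)).eval x -
        n * (n + 2 * α + 1) * (ultraPoly α n).eval x := by
  rcases n with _ | n
  · simp [ultraPoly_zero]
  have hp : (1 - X ^ 2) * derivative (ultraPoly α (n + 1)) =
      C ((n : ℝ) + 1) * (ultraPoly α n - X * ultraPoly α (n + 1)) :=
    Polynomial.funext fun x => by
      simpa using ultraPoly_derivative_eval hα n x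
  have d := congrArg (fun p => (derivative p).eval x) hp
  have e := congrArg (eval x) (ultraPoly_derivative_raise hα n)
  simp only [derivative_mul, derivative_C, derivative_X, derivative_sub, derivative_one,
    derivative_X_pow, eval_mul, eval_sub, eval_add, eval_C, eval_X, eval_pow, eval_one, eval_zero,
    zero_mul, zero_add, one_mul] at d e
  push_cast at *
  linear_combination d + e

/-! ### Orthogonality and norms -/

lemma intervalIntegrable_ultraWeight {α : ℝ} (hα : -1 < α) :
    IntervalIntegrable (fun x : ℝ => (1 - x ^ 2) ^ α) MeasureTheory.volume (-1) 1 := by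
  have h1 : IntervalIntegrable (fun x : ℝ => (1 - x ^ 2) ^ α) MeasureTheory.volume 0 1 := by
    have h := ((intervalIntegral.intervalIntegrable_rpow' hα (a := 0) (b := 1)).comp_sub_left 1).symm
    simp only [sub_zero, sub_self] at h
    have hc : ContinuousOn (fun x : ℝ => (1 + x) ^ α) (Set.uIcc 0 1) := by
      refine ContinuousOn.rpow_const (by fun_prop) fun x hx => Or.inl ?_
      rw [Set.uIcc_of_le zero_le_one] at hx
      linarith [hx.1]
    refine (h.mul_continuousOn hc).congr fun x hx => ?_
    rw [Set.uIoc_of_le zero_le_one] at hx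
    change (1 - x) ^ α * (1 + x) ^ α = (1 - x ^ 2) ^ α
    rw [← Real.mul_rpow (by linarith [hx.2]) (by linarith [hx.1])]
    ring_nf
  have h2 := (h1.comp_sub_left 0).symm
  simp only [zero_sub, neg_sq, sub_zero] at h2
  exact h2.trans h1

lemma intervalIntegrable_eval_mul_ultraWeight {α : ℝ} (hα : -1 < α) (p : ℝ[X]) :
    IntervalIntegrable (fun x : ℝ => p.eval x * (1 - x ^ 2) ^ α) MeasureTheory.volume (-1) 1 :=
  (intervalIntegrable_ultraWeight hα).continuousOn_mul p.continuous.continuousOn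

/-- The mean of a polynomial with respect to the probability measure `c_α (1 - x²)^α dx`. -/
noncomputable def ultraMean (α : ℝ) (p : ℝ[X]) : ℝ :=
  ultraConst α * ∫ x in (-1 : ℝ)..1, p.eval x * (1 - x ^ 2) ^ α

lemma ultraMean_sub {α : ℝ} (hα : -1 < α) (p q : ℝ[X]) :
    ultraMean α (p - q) = ultraMean α p - ultraMean α q := by
  unfold ultraMean
  rw [← mul_sub, ← intervalIntegral.integral_sub (intervalIntegrable_eval_mul_ultraWeight hα p)
    (intervalIntegrable_eval_mul_ultraWeight hα q)]
  simp only [eval_sub, sub_mul]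

lemma ultraMean_C_mul (α c : ℝ) (p : ℝ[X]) :
    ultraMean α (C c * p) = c * ultraMean α p := by
  unfold ultraMean
  simp only [eval_mul, eval_C, mul_assoc, intervalIntegral.integral_const_mul]
  ring

lemma ultraMean_one {α : ℝ} (hα : -1 < α) : ultraMean α 1 = 1 := by
  have h : 0 < ∫ x in (-1 : ℝ)..1, (1 - x ^ 2) ^ α := by
    refine intervalIntegral.intervalIntegral_pos_of_pos_on (intervalIntegrable_ultraWeight hα)
      (fun x hx => Real.rpow_pos_of_pos ?_ _) (by norm_num)
    nlinarith [hx.1, hx.2]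
  simp only [ultraMean, ultraConst, eval_one, one_mul]
  exact inv_mul_cancel₀ h.ne'

/-- Integration by parts: the integrand is the derivative of `(1 - x²)^(α+1) p(x)`, which vanishes
at both end points. -/
theorem ultraMean_by_parts {α : ℝ} (hα : -1 < α) (p : ℝ[X]) :
    ultraMean α ((1 - X ^ 2) * derivative p - C (2 * α + 2) * (X * p)) = 0 := by
  have h := intervalIntegral.integral_eq_sub_of_hasDerivAt_of_le (a := -1) (b := 1) (by norm_num)
    (f := fun x : ℝ => (1 - x ^ 2) ^ (α + 1) * p.eval x)
    (f' := fun x => ((1 - X ^ 2) * derivative p - C (2 * α + 2) * (X * p)).eval x *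
      (1 - x ^ 2) ^ α) ?_ ?_ (intervalIntegrable_eval_mul_ultraWeight hα _)
  · unfold ultraMean
    rw [h]
    simp [Real.zero_rpow (by linarith : α + 1 ≠ 0)]
  · refine ContinuousOn.mul (ContinuousOn.rpow_const (by fun_prop) fun x _ => Or.inr ?_)
      p.continuous.continuousOn
    linarith
  · intro x hx
    have hpos : 0 < 1 - x ^ 2 := by nlinarith [hx.1, hx.2]
    have hw : HasDerivAt (fun x : ℝ => 1 - x ^ 2) (-(2 * x)) x := by
      simpa using ((hasDerivAt_pow 2 x).const_sub 1)
    refine ((hw.rpow_const (p := α + 1) (Or.inl hpos.ne')).mul (p.hasDerivAt x)).congr_deriv ?_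
    simp only [eval_mul, eval_sub, eval_C, eval_X, eval_pow, eval_one, add_sub_cancel_right,
      Real.rpow_add_one hpos.ne']
    ring

lemma ultraMean_derivative_mul {α : ℝ} (hα : -1 < α) (m n : ℕ) :
    ultraMean α ((1 - X ^ 2) * (derivative (ultraPoly α m) * derivative (ultraPoly α n))) =
      n * (n + 2 * α + 1) * ultraMean α (ultraPoly α m * ultraPoly α n) := by
  have h := ultraMean_by_parts hα (ultraPoly α m * derivative (ultraPoly α n))
  have e : (1 - X ^ 2) * derivative (ultraPoly α m * derivative (ultraPoly α n)) -
      C (2 * α + 2) * (X * (ultraPoly α m * derivative (ultraPoly α n))) =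
      (1 - X ^ 2) * (derivative (ultraPoly α m) * derivative (ultraPoly α n)) -
        C (n * (n + 2 * α + 1)) * (ultraPoly α m * ultraPoly α n) := by
    refine Polynomial.funext fun x => ?_
    simp only [derivative_mul, eval_mul, eval_sub, eval_add, eval_C, eval_X, eval_pow, eval_one]
    linear_combination (ultraPoly α m).eval x * ultraPoly_ode hα n x
  rw [e, ultraMean_sub hα, ultraMean_C_mul] at h
  linarith

/-- The polynomials are eigenfunctions of one symmetric operator for the distinct eigenvalues
`n (n + 2α + 1)`. -/
theorem ultraPoly_orthogonal {α : ℝ} (hα : -1 < α) {m n : ℕ} (hmn : m < n) :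
    ultraMean α (ultraPoly α m * ultraPoly α n) = 0 := by
  have h1 := ultraMean_derivative_mul hα m n
  have h2 := ultraMean_derivative_mul hα n m
  rw [mul_comm (derivative _), mul_comm (ultraPoly α n)] at h2
  have hn : (m : ℝ) + 1 ≤ n := by exact_mod_cast hmn
  have hm : (0 : ℝ) ≤ m := m.cast_nonneg
  have h3 : ((n : ℝ) - m) * (n + m + 2 * α + 1) *
      ultraMean α (ultraPoly α m * ultraPoly α n) = 0 := by linear_combination h2 - h1
  refine (mul_eq_zero.1 h3).resolve_left (mul_ne_zero (by linarith) (by linarith))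

/-- The squared norm of the ultraspherical polynomial normalized by the value `1` at `1`. -/
noncomputable def ultraNormSq (α : ℝ) (n : ℕ) : ℝ :=
  ultraMean α (ultraPoly α n * ultraPoly α n)

lemma ultraNormSq_zero {α : ℝ} (hα : -1 < α) : ultraNormSq α 0 = 1 := by
  simp [ultraNormSq, ultraPoly_zero, ultraMean_one hα]

lemma ultraNormSq_one {α : ℝ} (hα : -1 < α) : (2 * α + 3) * ultraNormSq α 1 = 1 := by
  have h := ultraMean_by_parts hα X
  have e : (1 - X ^ 2) * derivative X - C (2 * α + 2) * (X * X) =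
      (1 : ℝ[X]) - C (2 * α + 3) * (X * X) := by
    refine Polynomial.funext fun x => ?_
    simp; ring
  rw [e, ultraMean_sub hα, ultraMean_C_mul, ultraMean_one hα] at h
  rw [ultraNormSq, ultraPoly_one hα]
  linarith

/-- Both sides are multiples of the mean of `x u_{n+1} u_{n+2}`, by the recurrence for `u_{n+2}`
and for `u_{n+3}`. -/
theorem ultraNormSq_succ {α : ℝ} (hα : -1 < α) (n : ℕ) :
    ((n : ℝ) + 2 * α + 2) * (2 * n + 2 * α + 5) * ultraNormSq α (n + 2) =
      (n + 2) * (2 * n + 2 * α + 3) * ultraNormSq α (n + 1) := by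
  have h1 := congrArg (fun p => ultraMean α (p * ultraPoly α (n + 2))) (ultraPoly_recurrence hα n)
  have h2 := congrArg (fun p => ultraMean α (p * ultraPoly α (n + 1)))
    (ultraPoly_recurrence hα (n + 1))
  simp only [sub_mul, mul_assoc, ultraMean_sub hα, ultraMean_C_mul] at h1 h2
  rw [mul_comm (ultraPoly α (n + 1 + 2)), ultraPoly_orthogonal hα (show n + 1 < n + 1 + 2 by omega),
    mul_comm (ultraPoly α (n + 1 + 1))] at h2
  rw [ultraPoly_orthogonal hα (show n < n + 2 by omega)] at h1
  unfold ultraNormSq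
  push_cast at h1 h2
  linear_combination (2 * n + 2 * α + 5) * h1 - (2 * n + 2 * α + 3) * h2

theorem ultraNormSq_pos {α : ℝ} (hα : -1 < α) (n : ℕ) : 0 < ultraNormSq α n := by
  rcases n with _ | n
  · simp [ultraNormSq_zero hα]
  induction n with
  | zero =>
    refine pos_of_mul_pos_right ?_ (by linarith : 0 ≤ 2 * α + 3)
    simp [ultraNormSq_one hα]
  | succ n ih =>
    have hn : (0 : ℝ) ≤ n := n.cast_nonneg
    have h : 0 < ((n : ℝ) + 2 * α + 2) * (2 * n + 2 * α + 5) :=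
      mul_pos (by linarith) (by linarith)
    refine pos_of_mul_pos_right ?_ h.le
    rw [ultraNormSq_succ hα]
    exact mul_pos (mul_pos (by linarith) (by linarith)) ih

theorem orthonormalJacobi_eq {α : ℝ} (hα : -1 < α) (n : ℕ) :
    orthonormalJacobi α n = C (√(ultraNormSq α n))⁻¹ * ultraPoly α n := by
  have hc : 0 < (ascPochhammer ℝ n).eval (α + 1) / (n.factorial : ℝ) :=
    div_pos (ascPochhammer_pos _ _ (by linarith)) (by positivity)
  have h : symmJacobiNormSq α n =
      ((ascPochhammer ℝ n).eval (α + 1) / (n.factorial : ℝ)) ^ 2 * ultraNormSq α n := by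
    rw [ultraNormSq, ← ultraMean_C_mul, symmJacobiNormSq, ultraMean, jacobiPoly_eq_ultraPoly hα]
    congr 2
    ext x
    simp only [eval_mul, eval_C]
    ring
  rw [orthonormalJacobi, h, jacobiPoly_eq_ultraPoly hα, ← mul_assoc, ← C_mul,
    Real.sqrt_mul (sq_nonneg _), Real.sqrt_sq hc.le, mul_inv, mul_comm _ (_⁻¹), mul_assoc,
    inv_mul_cancel₀ hc.ne', mul_one]

/-! ### A Turán-type inequality for increasing recurrence coefficients -/

/-- The Turán-type form `a_n² (p_{n+1}² + p_n²) - a_n x p_{n+1} p_n` grows with `n` by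
`(a_{n+1}² - a_n²) p_{n+1}²`, and it starts from `a_0²`. -/
lemma sq_le_turan_form {p a : ℕ → ℝ} {x : ℝ} (h0 : p 0 = 1) (h1 : a 0 * p 1 = x)
    (h : ∀ n, x * p (n + 1) = a (n + 1) * p (n + 2) + a n * p n)
    (ha0 : ∀ n, 0 ≤ a n) (ha : Monotone a) (n : ℕ) :
    a 0 ^ 2 ≤ a n ^ 2 * (p (n + 1) ^ 2 + p n ^ 2) - a n * x * p (n + 1) * p n := by
  induction n with
  | zero =>
    rw [zero_add, h0, ← h1]
    exact le_of_eq (by ring)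
  | succ n ih =>
    have hle : a n ^ 2 ≤ a (n + 1) ^ 2 := pow_le_pow_left₀ (ha0 n) (ha n.le_succ) 2
    have e : a (n + 1) * p (n + 2) = x * p (n + 1) - a n * p n := by linarith [h n]
    have key : a (n + 1) ^ 2 * (p (n + 2) ^ 2 + p (n + 1) ^ 2) -
        a (n + 1) * x * p (n + 2) * p (n + 1) =
        a n ^ 2 * (p (n + 1) ^ 2 + p n ^ 2) - a n * x * p (n + 1) * p n +
          (a (n + 1) ^ 2 - a n ^ 2) * p (n + 1) ^ 2 := by
      linear_combination (a (n + 1) * p (n + 2) - a n * p n) * e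
    rw [show n + 1 + 1 = n + 2 from rfl, key]
    nlinarith [mul_nonneg (sub_nonneg.2 hle) (sq_nonneg (p (n + 1)))]

/-- A lower bound for orthonormal polynomials on `[-1, 1]` whose recurrence coefficients increase
and stay below `1 / 2`. -/
theorem two_mul_sq_le_add_sq {p a : ℕ → ℝ} {x : ℝ} (h0 : p 0 = 1) (h1 : a 0 * p 1 = x)
    (h : ∀ n, x * p (n + 1) = a (n + 1) * p (n + 2) + a n * p n)
    (ha0 : ∀ n, 0 ≤ a n) (ha : Monotone a) (ha2 : ∀ n, a n ≤ 1 / 2) (hx : |x| ≤ 1) (n : ℕ) :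
    2 * a 0 ^ 2 ≤ p (n + 1) ^ 2 + p n ^ 2 := by
  have ht := sq_le_turan_form h0 h1 h ha0 ha n
  have hcross : -(x * (p (n + 1) * p n)) ≤ (p (n + 1) ^ 2 + p n ^ 2) / 2 := by
    have h2 : |x| * |p (n + 1) * p n| ≤ 1 * |p (n + 1) * p n| :=
      mul_le_mul_of_nonneg_right hx (abs_nonneg _)
    rw [← abs_mul] at h2
    have h3 : |p (n + 1) * p n| ≤ (p (n + 1) ^ 2 + p n ^ 2) / 2 := by
      rw [abs_le]
      constructor
      · nlinarith [sq_nonneg (p (n + 1) + p n)]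
      · nlinarith [sq_nonneg (p (n + 1) - p n)]
    linarith [neg_le_abs (x * (p (n + 1) * p n))]
  have hS : 0 ≤ p (n + 1) ^ 2 + p n ^ 2 := by positivity
  have hq : a n ^ 2 ≤ 1 / 4 := by nlinarith [ha0 n, ha2 n]
  nlinarith [mul_le_mul_of_nonneg_left hcross (ha0 n), mul_le_mul_of_nonneg_right hq hS,
    mul_le_mul_of_nonneg_right (ha2 n) hS]

/-! ### The lower bound for `α ≥ 1/2` -/

/-- The coefficient `a_{n+1}` of the recurrence `x p_n = a_{n+1} p_{n+1} + a_n p_{n-1}` for the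
orthonormal polynomials, for `α ≥ 1/2`; the index is shifted to start from `0`, and the closed form
is the one that shows its monotonicity. -/
noncomputable def ultraRec (α : ℝ) (n : ℕ) : ℝ :=
  √((1 - (2 * α + 1) * (2 * α - 1) / ((2 * n + 2 * α + 3) * (2 * n + 2 * α + 1))) / 4)

lemma ultraRec_arg_eq {α : ℝ} (hα : 1 / 2 ≤ α) (n : ℕ) :
    (1 - (2 * α + 1) * (2 * α - 1) / ((2 * n + 2 * α + 3) * (2 * n + 2 * α + 1))) / 4 =
      (n + 1) * (n + 2 * α + 1) / ((2 * n + 2 * α + 3) * (2 * n + 2 * α + 1)) := by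
  have hn : (0 : ℝ) ≤ n := n.cast_nonneg
  have h1 : 2 * (n : ℝ) + 2 * α + 3 ≠ 0 := by linarith
  have h2 : 2 * (n : ℝ) + 2 * α + 1 ≠ 0 := by linarith
  field_simp
  ring

lemma ultraRec_sq {α : ℝ} (hα : 1 / 2 ≤ α) (n : ℕ) :
    ultraRec α n ^ 2 =
      (n + 1) * (n + 2 * α + 1) / ((2 * n + 2 * α + 3) * (2 * n + 2 * α + 1)) := by
  have hn : (0 : ℝ) ≤ n := n.cast_nonneg
  rw [ultraRec, ultraRec_arg_eq hα, Real.sq_sqrt]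
  exact div_nonneg (mul_nonneg (by linarith) (by linarith))
    (mul_nonneg (by linarith) (by linarith))

lemma ultraRec_nonneg (α : ℝ) (n : ℕ) : 0 ≤ ultraRec α n := Real.sqrt_nonneg _

lemma ultraRec_monotone {α : ℝ} (hα : 1 / 2 ≤ α) : Monotone (ultraRec α) := by
  refine monotone_nat_of_le_succ fun n => Real.sqrt_le_sqrt ?_
  have hn : (0 : ℝ) ≤ n := n.cast_nonneg
  have hc : 0 ≤ (2 * α + 1) * (2 * α - 1) := mul_nonneg (by linarith) (by linarith)
  have hd : 0 < (2 * (n : ℝ) + 2 * α + 3) * (2 * n + 2 * α + 1) :=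
    mul_pos (by linarith) (by linarith)
  refine div_le_div_of_nonneg_right (sub_le_sub_left (div_le_div_of_nonneg_left hc hd ?_) 1)
    (by norm_num)
  push_cast
  exact mul_le_mul (by linarith) (by linarith) (by linarith) (by linarith)

lemma ultraRec_le_half {α : ℝ} (hα : 1 / 2 ≤ α) (n : ℕ) : ultraRec α n ≤ 1 / 2 := by
  have hn : (0 : ℝ) ≤ n := n.cast_nonneg
  refine Real.sqrt_le_iff.2 ⟨by norm_num, ?_⟩
  have : 0 ≤ (2 * α + 1) * (2 * α - 1) / ((2 * n + 2 * α + 3) * (2 * n + 2 * α + 1)) :=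
    div_nonneg (mul_nonneg (by linarith) (by linarith)) (mul_nonneg (by linarith) (by linarith))
  linarith

lemma ultraNormSq_ratio {α : ℝ} (hα : 1 / 2 ≤ α) (n : ℕ) :
    ((n : ℝ) + 2 * α + 1) * (2 * n + 2 * α + 3) * ultraNormSq α (n + 1) =
      (n + 1) * (2 * n + 2 * α + 1) * ultraNormSq α n := by
  have hα' : -1 < α := by linarith
  rcases n with _ | n
  · simp only [Nat.cast_zero, ultraNormSq_zero hα', zero_add, mul_zero]
    linear_combination (2 * α + 1) * ultraNormSq_one hα'
  · push_cast
    linear_combination ultraNormSq_succ hα' n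

lemma sqrt_ultraNormSq_succ {α : ℝ} (hα : 1 / 2 ≤ α) (n : ℕ) :
    (n + 2 * α + 1) * √(ultraNormSq α (n + 1)) =
      (2 * n + 2 * α + 1) * √(ultraNormSq α n) * ultraRec α n := by
  have hn : (0 : ℝ) ≤ n := n.cast_nonneg
  have hα' : -1 < α := by linarith
  have h1 : 2 * (n : ℝ) + 2 * α + 3 ≠ 0 := by linarith
  have h2 : 2 * (n : ℝ) + 2 * α + 1 ≠ 0 := by linarith
  refine (pow_left_inj₀ (mul_nonneg (by linarith) (Real.sqrt_nonneg _))
    (mul_nonneg (mul_nonneg (by linarith) (Real.sqrt_nonneg _)) (ultraRec_nonneg α n))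
    two_ne_zero).1 ?_
  rw [mul_pow, mul_pow, mul_pow, ultraRec_sq hα, Real.sq_sqrt (ultraNormSq_pos hα' _).le,
    Real.sq_sqrt (ultraNormSq_pos hα' _).le]
  field_simp
  linear_combination ultraNormSq_ratio hα n

lemma sqrt_ultraNormSq_pred {α : ℝ} (hα : 1 / 2 ≤ α) (n : ℕ) :
    (n + 1) * √(ultraNormSq α n) =
      (2 * n + 2 * α + 3) * √(ultraNormSq α (n + 1)) * ultraRec α n := by
  have hn : (0 : ℝ) ≤ n := n.cast_nonneg
  have hα' : -1 < α := by linarith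
  have h1 : 2 * (n : ℝ) + 2 * α + 3 ≠ 0 := by linarith
  have h2 : 2 * (n : ℝ) + 2 * α + 1 ≠ 0 := by linarith
  refine (pow_left_inj₀ (mul_nonneg (by linarith) (Real.sqrt_nonneg _))
    (mul_nonneg (mul_nonneg (by linarith) (Real.sqrt_nonneg _)) (ultraRec_nonneg α n))
    two_ne_zero).1 ?_
  rw [mul_pow, mul_pow, mul_pow, ultraRec_sq hα, Real.sq_sqrt (ultraNormSq_pos hα' _).le,
    Real.sq_sqrt (ultraNormSq_pos hα' _).le]
  field_simp
  linear_combination -ultraNormSq_ratio hα n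

lemma orthonormalJacobi_eval {α : ℝ} (hα : -1 < α) (n : ℕ) (x : ℝ) :
    (orthonormalJacobi α n).eval x = (ultraPoly α n).eval x / √(ultraNormSq α n) := by
  rw [orthonormalJacobi_eq hα, eval_mul, eval_C, div_eq_inv_mul]

lemma orthonormalJacobi_eval_sq {α : ℝ} (hα : -1 < α) (n : ℕ) (x : ℝ) :
    (orthonormalJacobi α n).eval x ^ 2 = (ultraPoly α n).eval x ^ 2 / ultraNormSq α n := by
  rw [orthonormalJacobi_eval hα, div_pow, Real.sq_sqrt (ultraNormSq_pos hα n).le]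

lemma orthonormalJacobi_recurrence {α : ℝ} (hα : 1 / 2 ≤ α) (n : ℕ) (x : ℝ) :
    x * (orthonormalJacobi α (n + 1)).eval x =
      ultraRec α (n + 1) * (orthonormalJacobi α (n + 2)).eval x +
        ultraRec α n * (orthonormalJacobi α n).eval x := by
  have hα' : -1 < α := by linarith
  have hn : (0 : ℝ) ≤ n := n.cast_nonneg
  have hs : ∀ m, √(ultraNormSq α m) ≠ 0 := fun m => (Real.sqrt_pos.2 (ultraNormSq_pos hα' m)).ne'
  have hu : ∀ m, (ultraPoly α m).eval x =
      √(ultraNormSq α m) * (orthonormalJacobi α m).eval x := fun m => by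
    rw [orthonormalJacobi_eval hα', mul_div_cancel₀ _ (hs m)]
  have r := ultraPoly_eval_recurrence hα' n x
  rw [hu, hu, hu] at r
  have e1 := sqrt_ultraNormSq_succ hα (n + 1)
  have e0 := sqrt_ultraNormSq_pred hα n
  push_cast at e1
  have hc : (2 * (n : ℝ) + 2 * α + 3) * √(ultraNormSq α (n + 1)) ≠ 0 :=
    mul_ne_zero (by linarith) (hs _)
  refine mul_left_cancel₀ hc ?_
  linear_combination (orthonormalJacobi α (n + 2)).eval x * e1 +
    (orthonormalJacobi α n).eval x * e0 - r

theorem le_orthonormalJacobi_add_sq {α : ℝ} (hα : 1 / 2 ≤ α) (n : ℕ) {x : ℝ} (hx : |x| ≤ 1) :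
    2 / (2 * α + 3) ≤ (orthonormalJacobi α (n + 1)).eval x ^ 2 +
      (orthonormalJacobi α n).eval x ^ 2 := by
  have hα' : -1 < α := by linarith
  have h0 : (orthonormalJacobi α 0).eval x = 1 := by
    simp [orthonormalJacobi_eval hα', ultraPoly_zero, ultraNormSq_zero hα']
  have h1 : ultraRec α 0 * (orthonormalJacobi α 1).eval x = x := by
    have e := sqrt_ultraNormSq_succ hα 0
    have hs := (Real.sqrt_pos.2 (ultraNormSq_pos hα' 1)).ne'
    have hc : 2 * α + 1 ≠ 0 := by linarith
    simp only [Nat.cast_zero, mul_zero, zero_add, ultraNormSq_zero hα', Real.sqrt_one, mul_one]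
      at e
    rw [← mul_left_cancel₀ hc e, orthonormalJacobi_eval hα', ultraPoly_one hα', eval_X,
      mul_div_cancel₀ _ hs]
  have h := two_mul_sq_le_add_sq (p := fun n => (orthonormalJacobi α n).eval x) h0 h1 (fun n => orthonormalJacobi_recurrence hα n x)
    (ultraRec_nonneg α) (ultraRec_monotone hα) (ultraRec_le_half hα) hx n
  rw [ultraRec_sq hα] at h
  refine le_of_eq_of_le ?_ h
  have h2 : 2 * α + 3 ≠ 0 := by linarith
  have h3 : 2 * α + 1 ≠ 0 := by linarith
  simp only [Nat.cast_zero, mul_zero, zero_add]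
  field_simp

lemma orthonormalJacobi_eval_one_sq_le {α : ℝ} (hα : -1 < α) (n : ℕ) {x : ℝ} (hx : 1 ≤ |x|) :
    (orthonormalJacobi α n).eval 1 ^ 2 ≤ (orthonormalJacobi α n).eval x ^ 2 := by
  rw [orthonormalJacobi_eval_sq hα, orthonormalJacobi_eval_sq hα, ultraPoly_eval_one, one_pow]
  exact div_le_div_of_nonneg_right (one_le_ultraPoly_eval_sq hα n hx) (ultraNormSq_pos hα n).le

theorem le_consecutiveInf_orthonormalJacobi {α : ℝ} (hα : 1 / 2 ≤ α) :
    2 / (2 * α + 3) ≤ consecutiveInf (orthonormalJacobi α) := by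
  refine le_csInf ⟨_, 0, 1, le_rfl, rfl⟩ ?_
  rintro _ ⟨x, n, hn, rfl⟩
  obtain ⟨n, rfl⟩ := Nat.exists_eq_add_of_le' hn
  rw [Nat.add_sub_cancel]
  rcases le_total |x| 1 with hx | hx
  · exact le_orthonormalJacobi_add_sq hα n hx
  · have hα' : -1 < α := by linarith
    exact (le_orthonormalJacobi_add_sq hα n (x := 1) (by simp)).trans
      (add_le_add (orthonormalJacobi_eval_one_sq_le hα' _ hx)
        (orthonormalJacobi_eval_one_sq_le hα' _ hx))

/-! ### A zero close to `1` and the preceding polynomial there -/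

/-- If `u_n` had no zero on `[x₀, 1]`, the function
`(1 - x²)^(α+1) (v u_n' - v' u_n)` with `v = (x - x₀)²` would be strictly decreasing there,
although it vanishes at both ends. -/
theorem exists_ultraPoly_eval_eq_zero {α : ℝ} (hα : -1 < α) (n : ℕ)
    (hn : (2 * α + 3) ^ 2 ≤ 2 * (n * (n + 2 * α + 1))) :
    ∃ x : ℝ, 0 ≤ x ∧ x ≤ 1 ∧ (1 - x) * (2 * (n * (n + 2 * α + 1))) ≤ (2 * α + 3) ^ 2 ∧
      (ultraPoly α n).eval x = 0 := by
  set μ : ℝ := n * (n + 2 * α + 1) with hμ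
  have hb : 0 < 2 * α + 3 := by linarith
  have hμ0 : 0 < μ := by nlinarith
  set δ : ℝ := (2 * α + 3) ^ 2 / (2 * μ) with hδ
  have hδ0 : 0 < δ := by positivity
  have hδ1 : δ ≤ 1 := (div_le_one (by positivity)).2 hn
  have hδμ : δ * (2 * μ) = (2 * α + 3) ^ 2 := div_mul_cancel₀ _ (by positivity)
  clear_value μ δ
  set u := ultraPoly α n with hu
  by_contra! hne
  have hpos : ∀ x ∈ Set.Icc (1 - δ) 1, 0 < u.eval x := by
    intro x hx
    by_contra! hle
    obtain ⟨y, hy, hy0⟩ := intermediate_value_Icc hx.2 u.continuous.continuousOn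
      (show (0 : ℝ) ∈ Set.Icc (u.eval x) (u.eval 1) from
        ⟨hle, by rw [hu, ultraPoly_eval_one]; exact zero_le_one⟩)
    refine hne y (by linarith [hx.1, hy.1]) hy.2 ?_ hy0
    rw [← hδμ]
    exact mul_le_mul_of_nonneg_right (by linarith [hx.1, hy.1]) (by positivity)
  set G : ℝ → ℝ := fun x => (1 - x ^ 2) ^ (α + 1) *
    ((x - (1 - δ)) ^ 2 * (derivative u).eval x - 2 * (x - (1 - δ)) * u.eval x) with hG
  have hGc : ContinuousOn G (Set.Icc (1 - δ) 1) := by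
    refine ContinuousOn.mul (ContinuousOn.rpow_const (by fun_prop) fun x _ => Or.inr ?_)
      (by fun_prop)
    linarith
  have hanti : StrictAntiOn G (Set.Icc (1 - δ) 1) := by
    refine strictAntiOn_of_deriv_neg (convex_Icc _ _) hGc fun x hx => ?_
    rw [interior_Icc] at hx
    have hx0 : 0 < x := by linarith [hx.1]
    have hx1 : 0 < 1 - x := by linarith [hx.2]
    have hw0 : 0 < 1 - x ^ 2 := by nlinarith
    have hw : HasDerivAt (fun x : ℝ => 1 - x ^ 2) (-(2 * x)) x := by
      simpa using ((hasDerivAt_pow 2 x).const_sub 1)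
    have hl : HasDerivAt (fun x : ℝ => x - (1 - δ)) 1 x := (hasDerivAt_id x).sub_const _
    have hd := (hw.rpow_const (p := α + 1) (Or.inl hw0.ne')).mul
      (((hl.pow 2).mul ((derivative u).hasDerivAt x)).sub ((hl.const_mul 2).mul (u.hasDerivAt x)))
    have hd' : HasDerivAt G (-((1 - x ^ 2) ^ α * u.eval x *
        (2 * (1 - x ^ 2) - (4 * α + 4) * x * (x - (1 - δ)) + μ * (x - (1 - δ)) ^ 2))) x := by
      refine hd.congr_deriv ?_
      have ode := ultraPoly_ode hα n x
      rw [← hμ] at ode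
      simp only [add_sub_cancel_right, Real.rpow_add_one hw0.ne', Pi.pow_apply, Pi.mul_apply,
        Pi.sub_apply]
      push_cast
      linear_combination (1 - x ^ 2) ^ α * (x - (1 - δ)) ^ 2 * ode
    rw [hd'.deriv, neg_lt_zero]
    refine mul_pos (mul_pos (Real.rpow_pos_of_pos hw0 _) (hpos x ⟨hx.1.le, hx.2.le⟩)) ?_
    set y := x - (1 - δ) with hy
    have hy0 : 0 < y := by linarith [hx.1]
    -- The choice of `δ` makes `2δ - (4α + 6) y + μ y²` a perfect square up to the factor `μ`.
    have hquad : 0 ≤ 2 * δ - (4 * α + 6) * y + μ * y ^ 2 := by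
      refine nonneg_of_mul_nonneg_right (a := μ) ?_ hμ0
      have : μ * (2 * δ - (4 * α + 6) * y + μ * y ^ 2) = (2 * α + 3 - μ * y) ^ 2 := by
        linear_combination hδμ
      rw [this]
      positivity
    have h1 : δ - y < 1 - x ^ 2 := by nlinarith
    have h2 : (4 * α + 4) * x * y ≤ (4 * α + 4) * y := by
      have : 0 ≤ (4 * α + 4) * y * (1 - x) :=
        mul_nonneg (mul_nonneg (by linarith) hy0.le) hx1.le
      linarith
    linarith
  have h := hanti (Set.left_mem_Icc.2 (by linarith)) (Set.right_mem_Icc.2 (by linarith))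
    (by linarith : 1 - δ < 1)
  simp only [hG, sub_self, one_pow, Real.zero_rpow (by linarith : α + 1 ≠ 0)] at h
  simp at h

/-- The energy `(1 - x²) u_n'² + n (n + 2α + 1) u_n²` increases on `[0, 1]`, its derivative being
`(4α + 2) x u_n'²`. -/
theorem ultraPoly_derivative_sq_le {α : ℝ} (hα : -(1 / 2) ≤ α) (n : ℕ) {x : ℝ} (hx0 : 0 ≤ x)
    (hx1 : x ≤ 1) :
    (1 - x ^ 2) * (derivative (ultraPoly α n)).eval x ^ 2 ≤ n * (n + 2 * α + 1) := by
  have hα' : -1 < α := by linarith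
  have hn : (0 : ℝ) ≤ n := n.cast_nonneg
  have hμ0 : 0 ≤ (n : ℝ) * (n + 2 * α + 1) := mul_nonneg hn (by linarith)
  set u := ultraPoly α n with hu
  set F : ℝ[X] := (1 - X ^ 2) * derivative u ^ 2 + C (n * (n + 2 * α + 1)) * u ^ 2 with hF
  have hmono : MonotoneOn (fun x => F.eval x) (Set.Icc 0 1) := by
    refine monotoneOn_of_deriv_nonneg (convex_Icc _ _) F.continuous.continuousOn
      F.differentiable.differentiableOn fun y hy => ?_
    rw [interior_Icc] at hy
    have e : (derivative F).eval y = (4 * α + 2) * y * (derivative u).eval y ^ 2 := by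
      simp only [hF, derivative_add, derivative_mul, derivative_C, derivative_sub, derivative_one,
        derivative_pow, derivative_X, eval_mul, eval_sub, eval_add, eval_C, eval_X, eval_pow,
        eval_one, eval_zero, zero_mul, zero_add]
      push_cast
      linear_combination 2 * (derivative u).eval y * ultraPoly_ode hα' n y
    rw [Polynomial.deriv, e]
    exact mul_nonneg (mul_nonneg (by linarith) hy.1.le) (sq_nonneg _)
  have h := hmono ⟨hx0, hx1⟩ (Set.right_mem_Icc.2 zero_le_one) hx1
  simp only [hF, eval_mul, eval_sub, eval_add, eval_C, eval_X, eval_pow, eval_one, hu,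
    ultraPoly_eval_one] at h
  have h2 : 0 ≤ (n : ℝ) * (n + 2 * α + 1) * u.eval x ^ 2 := mul_nonneg hμ0 (sq_nonneg _)
  linarith

/-- At a zero of `u_{n+1}` close to `1` the preceding polynomial is of order `1 / n`. -/
theorem exists_orthonormalJacobi_add_sq_le {α : ℝ} (hα : -(1 / 2) ≤ α) (n : ℕ)
    (hn : (2 * α + 3) ^ 2 ≤ 2 * ((n + 1) * (n + 2 * α + 2))) :
    ∃ x : ℝ, (orthonormalJacobi α (n + 1)).eval x ^ 2 + (orthonormalJacobi α n).eval x ^ 2 ≤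
      (2 * α + 3) ^ 2 / ((n + 1) ^ 2 * ultraNormSq α n) := by
  have hα' : -1 < α := by linarith
  have hμ : (((n + 1 : ℕ) : ℝ)) * (((n + 1 : ℕ) : ℝ) + 2 * α + 1) = (n + 1) * (n + 2 * α + 2) := by
    push_cast; ring
  obtain ⟨x, hx0, hx1, hx, hu⟩ := exists_ultraPoly_eval_eq_zero hα' (n + 1) (by rwa [hμ])
  have hd := ultraPoly_derivative_eval hα' n x
  have he := ultraPoly_derivative_sq_le hα (n + 1) hx0 hx1
  rw [hμ] at hx he
  rw [hu, mul_zero, sub_zero] at hd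
  have hn0 : (0 : ℝ) ≤ n := n.cast_nonneg
  have hw : 0 ≤ 1 - x ^ 2 := by nlinarith
  have hμ0 : 0 ≤ ((n : ℝ) + 1) * (n + 2 * α + 2) := mul_nonneg (by linarith) (by linarith)
  have key : ((n : ℝ) + 1) ^ 2 * (ultraPoly α n).eval x ^ 2 ≤ (2 * α + 3) ^ 2 := by
    calc ((n : ℝ) + 1) ^ 2 * (ultraPoly α n).eval x ^ 2
        = (1 - x ^ 2) * ((1 - x ^ 2) * (derivative (ultraPoly α (n + 1))).eval x ^ 2) := by
          rw [← mul_pow, ← hd]; ring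
      _ ≤ (1 - x ^ 2) * ((n + 1) * (n + 2 * α + 2)) := mul_le_mul_of_nonneg_left he hw
      _ ≤ (1 - x) * (2 * ((n + 1) * (n + 2 * α + 2))) := by
          have h2 : 1 - x ^ 2 ≤ (1 - x) * 2 := by nlinarith
          exact (mul_le_mul_of_nonneg_right h2 hμ0).trans_eq (mul_assoc _ _ _)
      _ ≤ (2 * α + 3) ^ 2 := hx
  refine ⟨x, ?_⟩
  have hH := ultraNormSq_pos hα' n
  rw [orthonormalJacobi_eval_sq hα', orthonormalJacobi_eval_sq hα', hu, zero_pow two_ne_zero,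
    zero_div, zero_add, ← div_div]
  refine div_le_div_of_nonneg_right ?_ hH.le
  rw [le_div_iff₀ (by positivity), mul_comm]
  exact key

/-! ### Vanishing of the infimum for `α < 1/2` -/

/-- The product of the factors `1 - c / (n + 1)` tends to zero because the harmonic series
diverges. -/
theorem tendsto_zero_of_succ_le {s : ℕ → ℝ} {c : ℝ} (hc : 0 < c) (hs : ∀ n, 0 ≤ s n)
    (h : ∀ n, s (n + 1) ≤ (1 - c / (n + 1)) * s n) :
    Filter.Tendsto s Filter.atTop (nhds 0) := by
  have hb : ∀ n, s n ≤ s 0 * Real.exp (-(c * ∑ i ∈ Finset.range n, 1 / ((i : ℝ) + 1))) := by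
    intro n
    induction n with
    | zero => simp
    | succ n ih =>
      calc s (n + 1) ≤ (1 - c / (n + 1)) * s n := h n
        _ ≤ Real.exp (-(c / (n + 1))) * s n :=
          mul_le_mul_of_nonneg_right (Real.one_sub_le_exp_neg _) (hs n)
        _ ≤ Real.exp (-(c / (n + 1))) *
            (s 0 * Real.exp (-(c * ∑ i ∈ Finset.range n, 1 / ((i : ℝ) + 1)))) :=
          mul_le_mul_of_nonneg_left ih (Real.exp_pos _).le
        _ = _ := by
          rw [Finset.sum_range_succ, mul_left_comm, ← Real.exp_add]
          congr 2
          ring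
  have ht := (Real.tendsto_exp_neg_atTop_nhds_zero.comp
    (Real.tendsto_sum_range_one_div_nat_succ_atTop.const_mul_atTop hc)).const_mul (s 0)
  rw [mul_zero] at ht
  exact squeeze_zero hs hb ht

lemma tendsto_ultraNormSq_inv_of_half {α : ℝ} (hα : -1 < α) (hα2 : α < 1 / 2) :
    Filter.Tendsto (fun n : ℕ => (ultraNormSq α (n + 1) * (2 * n + 2 * α + 3) * (n + 2))⁻¹)
      Filter.atTop (nhds 0) := by
  have hpos : ∀ n : ℕ, 0 < ultraNormSq α (n + 1) * (2 * n + 2 * α + 3) * (n + 2) := fun n => by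
    have hn : (0 : ℝ) ≤ n := n.cast_nonneg
    exact mul_pos (mul_pos (ultraNormSq_pos hα _) (by linarith)) (by linarith)
  refine tendsto_zero_of_succ_le (c := (1 - 2 * α) / 3) (by linarith)
    (fun n => (inv_pos.2 (hpos n)).le) fun n => ?_
  have hn : (0 : ℝ) ≤ n := n.cast_nonneg
  have e : (ultraNormSq α (n + 1 + 1) * (2 * ((n + 1 : ℕ) : ℝ) + 2 * α + 3) *
      (((n + 1 : ℕ) : ℝ) + 2))⁻¹ = (1 - (1 - 2 * α) / (n + 3)) *
        (ultraNormSq α (n + 1) * (2 * n + 2 * α + 3) * (n + 2))⁻¹ := by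
    have h1 := (hpos (n + 1)).ne'
    have h3 : (n : ℝ) + 3 ≠ 0 := by linarith
    rw [← div_eq_mul_inv, eq_div_iff (hpos n).ne', inv_mul_eq_iff_eq_mul₀ h1]
    push_cast
    field_simp
    linear_combination (-((n : ℝ) + 3)) * ultraNormSq_succ hα n
  rw [e]
  -- The exact factor has the denominator `n + 3 ≤ 3 (n + 1)`; this is where `c` loses a factor `3`.
  refine mul_le_mul_of_nonneg_right (sub_le_sub_left ?_ 1) (inv_pos.2 (hpos n)).le
  rw [div_div]
  exact div_le_div_of_nonneg_left (by linarith) (by linarith) (by linarith)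

lemma tendsto_ultraNormSq_inv_of_neg {α : ℝ} (hα : -1 < α) (hα2 : α < -(1 / 2)) :
    Filter.Tendsto (fun n : ℕ => (n + 1) * (ultraNormSq α (n + 1) * (2 * n + 2 * α + 3))⁻¹)
      Filter.atTop (nhds 0) := by
  have hpos : ∀ n : ℕ, 0 < ultraNormSq α (n + 1) * (2 * n + 2 * α + 3) := fun n => by
    have hn : (0 : ℝ) ≤ n := n.cast_nonneg
    exact mul_pos (ultraNormSq_pos hα _) (by linarith)
  refine tendsto_zero_of_succ_le (c := -1 - 2 * α) (by linarith)
    (fun n => mul_nonneg (by positivity) (inv_pos.2 (hpos n)).le) fun n => le_of_eq ?_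
  have h1 := (hpos (n + 1)).ne'
  have h3 : (n : ℝ) + 1 ≠ 0 := by positivity
  rw [← div_eq_mul_inv, ← div_eq_mul_inv, ← mul_div_assoc, div_eq_div_iff h1 (hpos n).ne']
  push_cast
  field_simp
  linear_combination -ultraNormSq_succ hα n

lemma consecutiveInf_eq_zero {P : ℕ → ℝ[X]} {f : ℕ → ℝ}
    (hf : Filter.Tendsto f Filter.atTop (nhds 0))
    (h : ∀ᶠ n in Filter.atTop, ∃ (x : ℝ) (m : ℕ),
      (P (m + 1)).eval x ^ 2 + (P m).eval x ^ 2 ≤ f n) : consecutiveInf P = 0 := by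
  have h0 : ∀ y ∈ {y : ℝ | ∃ (x : ℝ) (n : ℕ), 1 ≤ n ∧
      y = ((P n).eval x) ^ 2 + ((P (n - 1)).eval x) ^ 2}, 0 ≤ y := by
    rintro _ ⟨x, n, -, rfl⟩
    positivity
  refine le_antisymm (ge_of_tendsto hf ?_) (Real.sInf_nonneg h0)
  filter_upwards [h] with n ⟨x, m, hx⟩
  exact (csInf_le ⟨0, h0⟩ ⟨x, m + 1, by omega, rfl⟩).trans hx

theorem consecutiveInf_orthonormalJacobi_eq_zero {α : ℝ} (hα : -1 < α) (hα2 : α < 1 / 2) :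
    consecutiveInf (orthonormalJacobi α) = 0 := by
  rcases le_or_gt (-(1 / 2)) α with h | h
  · have ht := (tendsto_ultraNormSq_inv_of_half hα hα2).const_mul (2 * (2 * α + 3) ^ 2)
    rw [mul_zero] at ht
    refine consecutiveInf_eq_zero ht ?_
    filter_upwards [Filter.eventually_ge_atTop 1] with n hn
    have hn1 : (1 : ℝ) ≤ n := by exact_mod_cast hn
    obtain ⟨x, hx⟩ := exists_orthonormalJacobi_add_sq_le h (n + 1) (by push_cast; nlinarith)
    refine ⟨x, n + 1, hx.trans ?_⟩
    have hH := ultraNormSq_pos hα (n + 1)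
    have h3 : 0 < 2 * (n : ℝ) + 2 * α + 3 := by linarith
    rw [mul_comm 2 ((2 * α + 3) ^ 2), mul_assoc, div_eq_mul_inv]
    refine mul_le_mul_of_nonneg_left ?_ (sq_nonneg (2 * α + 3))
    push_cast
    rw [← div_eq_mul_inv, le_div_iff₀ (by positivity), inv_mul_le_iff₀ (by positivity)]
    have : (2 * (n : ℝ) + 2 * α + 3) * (ultraNormSq α (n + 1) * (n + 2)) ≤
        (2 * (n + 2)) * (ultraNormSq α (n + 1) * (n + 2)) :=
      mul_le_mul_of_nonneg_right (by linarith) (by positivity)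
    linarith
  · have ht := (tendsto_ultraNormSq_inv_of_neg hα h).const_mul 2
    -- At `x = 1` the sum is `1 / h_{n+2} + 1 / h_{n+1}`.
    have ht2 := ((Filter.tendsto_add_atTop_iff_nat 1).2 ht).add ht
    rw [mul_zero, add_zero] at ht2
    refine consecutiveInf_eq_zero ht2 (Filter.Eventually.of_forall fun n => ⟨1, n + 1, ?_⟩)
    have hb : ∀ m : ℕ, (orthonormalJacobi α (m + 1)).eval 1 ^ 2 ≤
        2 * ((m + 1) * (ultraNormSq α (m + 1) * (2 * m + 2 * α + 3))⁻¹) := by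
      intro m
      have hm : (0 : ℝ) ≤ m := m.cast_nonneg
      have hH := ultraNormSq_pos hα (m + 1)
      have h3 : 0 < 2 * (m : ℝ) + 2 * α + 3 := by linarith
      rw [orthonormalJacobi_eval_sq hα, ultraPoly_eval_one, one_pow, ← div_eq_mul_inv,
        ← mul_div_assoc, div_le_div_iff₀ hH (mul_pos hH h3), one_mul, mul_comm]
      exact mul_le_mul_of_nonneg_right (by linarith) hH.le
    exact add_le_add (hb (n + 1)) (hb n)

theorem mainTheorem8 (α : ℝ) :
    (1 / 2 ≤ α → 2 / (2 * α + 3) ≤ consecutiveInf (orthonormalJacobi α)) ∧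
    (-1 < α → α < 1 / 2 →
      consecutiveInf (orthonormalJacobi α) = 0 ∧
        ¬ LowerBounded (orthonormalJacobi α)) := by
  refine ⟨le_consecutiveInf_orthonormalJacobi, fun h1 h2 => ?_⟩
  have h := consecutiveInf_orthonormalJacobi_eq_zero h1 h2
  exact ⟨h, fun hL => hL.ne' h⟩
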